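/- Let $G=(V,E_{\to},E_{\leftrightarrow})$ be a finite mixed graph without self-loops. Write $\mathrm{pa}(i)=\{j: j\to i\}$ and $\mathrm{sib}(i)=\{j: j\leftrightarrow i\}$. Let $\mathbf B(G)$ be the set of real $V\times V$ matrices $B=(\beta_{ij})$ with $I-B$ invertible and $\beta_{ij}=0$ whenever $j\to i\notin E_{\to}$, and let $\mathbf\Omega(G)$ be the set of symmetric positive definite real $V\times V$ matrices $\Omega=(\omega_{ij})$ with $\omega_{ij}=0$ whenever $i\neq j$ and $j\leftrightarrow i\notin E_{\leftrightarrow}$. The model $\mathbf N(G)$ is the family of normal distributions $\mathcal N(0,\Sigma(B,\Omega))$ with $\Sigma(B,\Omega)=(I-B)^{-1}\Omega(I-B)^{-T}$, $(B,\Omega)\in\mathbf B(G)\times\mathbf\Omega(G)$; its parameters are identifiable if the map $(B,\Omega)\mapsto\mathcal N(0,\Sigma(B,\Omega))$ is injective on $\mathbf B(G)\times\mathbf\Omega(G)$. A half-collider path is a path $i_1,\dots,i_k$ ($k\ge1$, vertices not necessarily distinct) in which either all edges are bi-directed, or the first edge is $i_1\to i_2$ and all other edges are bi-directed; its bi-directed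 portion is $\{i_1,\dots,i_k\}$ in the first case and $\{i_2,\dots,i_k\}$ in the second. A system of half-collider paths from $S_b$ to $S_e$, where $|S_b|=|S_e|=s$, consists of $s$ half-collider paths, each from a node in $S_b$ to a node in $S_e$, such that every node in $S_b$ is the first node of some path and every node in $S_e$ is the last node of some path. Consider the condition: (a) For all $i\in V$, the induced subgraph $G_{-i}$ on $V\setminus\{i\}$ contains a system of half-collider paths from a subset of $V\setminus(\mathrm{pa}(i)\cup\{i\})$ to $\mathrm{sib}(i)$ whose bi-directed portions are pairwise disjoint. If (a) fails for $G$, then the parameters $(B,\Omega)$ of the model $\mathbf N(G)$ are not identifiable. More precisely, in that case, for every $(B,\Omega)\in\mathbf B(G)\times\mathbf\Omega(G)$ there are infinitely many $(B',\Omega')\in\mathbf B(G)\times\mathbf\Omega(G)$ with $\Sigma(B',\Omega')=\Sigma(B,\Omega)$. -/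

import Mathlib

/-- A mixed graph on the vertex set `V`, without self-loops: `dir i j` means `i → j`, and
`bidir.Adj i j` means `i ↔ j`. -/
structure MixedGraph (V : Type*) where
  dir : V → V → Prop
  dir_irrefl : ∀ i, ¬ dir i i
  bidir : SimpleGraph V

namespace MixedGraph

variable {V : Type*}

/-- The parents of `i`. -/
def pa (G : MixedGraph V) (i : V) : Set V := {j | G.dir j i}

/-- The siblings of `i`. -/
def sib (G : MixedGraph V) (i : V) : Set V := {j | G.bidir.Adj j i}

/-- The induced subgraph on a set of vertices. -/
def induce (G : MixedGraph V) (s : Set V) : MixedGraph s where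
  dir a b := G.dir a b
  dir_irrefl a := G.dir_irrefl a
  bidir := G.bidir.induce s

/-- The induced subgraph `G_{-i}` on `V \ {i}`. -/
abbrev remove (G : MixedGraph V) (i : V) : MixedGraph ({i}ᶜ : Set V) := G.induce {i}ᶜ

/-- Half-collider paths: either all edges are bi-directed (possibly there is no edge at all), or
the first edge is directed, pointing away from the first vertex, and all other edges are
bi-directed. Vertices may be repeated. -/
inductive HalfColliderPath (G : MixedGraph V) : V → V → Type _
  | bidirected {a b : V} (w : G.bidir.Walk a b) : HalfColliderPath G a b
  | directed {a b c : V} (h : G.dir a b) (w : G.bidir.Walk b c) : HalfColliderPath G a c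

/-- The bi-directed portion: all vertices of the path, except for the starting point of the first
edge if that edge is directed (which may still occur later on the path). -/
def HalfColliderPath.bidirectedPortion {G : MixedGraph V} {a b : V} :
    G.HalfColliderPath a b → Set V
  | .bidirected w => {v | v ∈ w.support}
  | .directed _ w => {v | v ∈ w.support}

/-- A system of `s` half-collider paths from `Sb` to `Se`. -/
structure HalfColliderSystem (G : MixedGraph V) (Sb Se : Set V) (s : ℕ) where
  encard_source : Sb.encard = s
  encard_target : Se.encard = s
  first : Fin s → V
  last : Fin s → V
  path : ∀ l, G.HalfColliderPath (first l) (last l)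
  first_mem : ∀ l, first l ∈ Sb
  last_mem : ∀ l, last l ∈ Se
  exists_first : ∀ v ∈ Sb, ∃ l, first l = v
  exists_last : ∀ v ∈ Se, ∃ l, last l = v

/-- The graphical condition at the node `i`: the induced subgraph `G_{-i}` contains a system of
half-collider paths from a subset of `V \ (pa(i) ∪ {i})` to `sib(i)` with pairwise disjoint
bi-directed portions. -/
def HalfColliderConditionAt (G : MixedGraph V) (i : V) : Prop :=
  ∃ Sb : Set ({i}ᶜ : Set V), (∀ v ∈ Sb, (v : V) ∉ G.pa i) ∧
    ∃ (s : ℕ) (P : (G.remove i).HalfColliderSystem Sb {v | (v : V) ∈ G.sib i} s),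
      ∀ l m, l ≠ m → Disjoint (P.path l).bidirectedPortion (P.path m).bidirectedPortion

/-- The graphical condition at all nodes. -/
def HalfColliderCondition (G : MixedGraph V) : Prop :=
  ∀ i, G.HalfColliderConditionAt i

variable [Fintype V] [DecidableEq V]

/-- `𝐁(G)`. -/
def coefficients (G : MixedGraph V) : Set (Matrix V V ℝ) :=
  {B | IsUnit (1 - B) ∧ ∀ i j, ¬ G.dir j i → B i j = 0}

/-- `𝛀(G)`; the diagonal entries are not restricted. -/
def errorCovariances (G : MixedGraph V) : Set (Matrix V V ℝ) :=
  {Ω | Ω.PosDef ∧ ∀ i j, i ≠ j → ¬ G.bidir.Adj j i → Ω i j = 0}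

/-- The parameter space `𝐁(G) × 𝛀(G)`. -/
def parameters (G : MixedGraph V) : Set (Matrix V V ℝ × Matrix V V ℝ) :=
  G.coefficients ×ˢ G.errorCovariances

end MixedGraph

/-- The covariance matrix `(I - B)⁻¹ Ω (I - B)⁻ᵀ` determined by `θ = (B, Ω)`. -/
noncomputable def semCovariance {V : Type*} [Fintype V] [DecidableEq V]
    (θ : Matrix V V ℝ × Matrix V V ℝ) : Matrix V V ℝ :=
  (1 - θ.1)⁻¹ * θ.2 * ((1 - θ.1)⁻¹).transpose

/-- The normal distribution `N(0, (I - B)⁻¹ Ω (I - B)⁻ᵀ)` determined by `θ = (B, Ω)`. -/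
noncomputable def semDistribution {V : Type*} [Fintype V] [DecidableEq V]
    (θ : Matrix V V ℝ × Matrix V V ℝ) : MeasureTheory.Measure (EuclideanSpace ℝ V) :=
  ProbabilityTheory.multivariateGaussian 0 (semCovariance θ)

/-- The parameters of the linear structural equation model `𝐍(G)` are identifiable: distinct
parameter pairs define distinct distributions. -/
def MixedGraph.ParametersIdentifiable {V : Type*} [Fintype V] [DecidableEq V]
    (G : MixedGraph V) : Prop :=
  Set.InjOn semDistribution G.parameters

/-! ### Half-collider systems read off from injective maps. -/

namespace MixedGraph

open Relation

variable {U : Type*}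

/-! If the condition fails at `i`, there is a nonzero row vector `u` such that `u Ω` vanishes off
`sib i ∪ {i}` and `u (1 - B)` vanishes off `pa i`. With `N = 1 - t • e_i uᵀ`, replacing `1 - B` by
`N (1 - B)` and `Ω` by `N Ω Nᵀ` changes only row `i` of `B` and row and column `i` of `Ω`, in
allowed positions, while `N` cancels in the covariance. All but at most one `t` make `N` invertible,
and distinct `t` give distinct parameters.

Suppose no such `u` exists. Then, with row and column `i` deleted, the columns of `Ω` outside `sib
i` and the columns of `1 - B` outside `pa i` together span. The former are independent because `Ω`
is positive definite, so they extend to a basis by some of the latter. A nonzero Leibniz term of the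
determinant matches rows with basis columns at nonzero entries, that is, along edges or equalities.
Following this matching from each sibling until it uses a column of `1 - B` traces, in reverse, a
half-collider path; injectivity keeps the paths disjoint. -/

/-- In a finite type, following an injective partial map that avoids the starting point
eventually leaves its domain. -/
lemma exists_reflTransGen_eq_inr [Finite U] {X : Type*} {f : U → U ⊕ X}
    (hf : Function.Injective f) {a : U} (ha : ∀ c, f c ≠ .inl a) :
    ∃ c x, ReflTransGen (fun c d => f c = .inl d) a c ∧ f c = .inr x := by
  by_contra! h
  have key : ∀ c : {c // ReflTransGen (fun c d => f c = .inl d) a c},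
      ∃ d : {c // ReflTransGen (fun c d => f c = .inl d) a c}, f c = .inl d := by
    rintro ⟨c, hc⟩
    cases hfc : f c with
    | inl d => exact ⟨⟨d, hc.tail hfc⟩, rfl⟩
    | inr x => exact absurd hfc (h c x hc)
  choose g hg using key
  have hginj : Function.Injective g := fun c d hcd =>
    Subtype.ext (hf ((hg c).trans ((congrArg _ (congrArg _ hcd)).trans (hg d).symm)))
  -- An orbit that never leaves would give an injective, hence surjective, self-map of a finite set,
  -- so `a` would have a preimage.
  obtain ⟨c, hc⟩ := Finite.injective_iff_surjective.1 hginj ⟨a, .refl⟩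
  exact ha c ((hg c).trans (by rw [hc]))

/-- Backward steps are unique, so two orbits that meet lie on one chain; neither starting point has
a predecessor. -/
lemma eq_of_reflTransGen_of_reflTransGen {X : Type*} {f : U → U ⊕ X}
    (hf : Function.Injective f) {a b c : U} (ha : ∀ c, f c ≠ .inl a) (hb : ∀ c, f c ≠ .inl b)
    (hac : ReflTransGen (fun c d => f c = .inl d) a c)
    (hbc : ReflTransGen (fun c d => f c = .inl d) b c) : a = b := by
  have hU : Relator.RightUnique (Function.swap fun c d => f c = Sum.inl (β := X) d) :=
    fun x y z hy hz => hf (hy.trans hz.symm)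
  rcases ReflTransGen.total_of_right_unique hU hac.swap hbc.swap with h | h
  · rcases ReflTransGen.cases_head h with h | ⟨d, hd, -⟩
    · exact h
    · exact absurd hd (ha d)
  · rcases ReflTransGen.cases_head h with h | ⟨d, hd, -⟩
    · exact h.symm
    · exact absurd hd (hb d)

lemma exists_walk_of_reflTransGen {X : Type*} {H : SimpleGraph U} {f : U → U ⊕ X}
    (hH : ∀ c d, f c = .inl d → c = d ∨ H.Adj c d) {a c : U}
    (hac : ReflTransGen (fun c d => f c = .inl d) a c) :
    ∃ w : H.Walk c a, ∀ v ∈ w.support, ReflTransGen (fun c d => f c = .inl d) a v := by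
  induction hac with
  | refl => exact ⟨.nil, by simp [ReflTransGen.refl]⟩
  | @tail c d hc hcd ih =>
    obtain ⟨w, hw⟩ := ih
    rcases hH c d hcd with rfl | h
    · exact ⟨w, hw⟩
    · refine ⟨.cons h.symm w, fun v hv => ?_⟩
      rcases List.mem_cons.1 (by simpa using hv) with rfl | hv
      · exact hc.tail hcd
      · exact hw v hv

/-- A bijection that matches every vertex with itself, a bi-directed neighbour outside `S`, or a
source of a directed edge into it, decomposes into a system of half-collider paths. -/
lemma exists_halfColliderSystem_of_injective [Finite U] (G : MixedGraph U) (S : Set U)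
    {f : U → U ⊕ U} (hf : Function.Injective f)
    (hS : ∀ c, c ∉ S ↔ ∃ d, f d = .inl c)
    (hbi : ∀ c d, f c = .inl d → c = d ∨ G.bidir.Adj c d)
    (hdir : ∀ c d, f c = .inr d → c = d ∨ G.dir d c) :
    ∃ (s : ℕ) (P : G.HalfColliderSystem {t | ∃ c, f c = .inr t} S s),
      ∀ l m, l ≠ m → Disjoint (P.path l).bidirectedPortion (P.path m).bidirectedPortion := by
  classical
  have hne : ∀ a : S, ∀ c, f c ≠ .inl (a : U) := fun a c h => (hS a).2 ⟨c, h⟩ a.2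
  have hpath : ∀ a : S, ∃ (t : U) (p : G.HalfColliderPath t a),
      (∃ c, ReflTransGen (fun c d => f c = .inl d) (a : U) c ∧ f c = .inr t) ∧
      ∀ v ∈ p.bidirectedPortion, ReflTransGen (fun c d => f c = .inl d) (a : U) v := by
    intro a
    obtain ⟨c, t, hac, hct⟩ := exists_reflTransGen_eq_inr hf (hne a)
    obtain ⟨w, hw⟩ := exists_walk_of_reflTransGen hbi hac
    rcases hdir c t hct with rfl | h
    · exact ⟨c, .bidirected w, ⟨c, hac, hct⟩, hw⟩
    · exact ⟨t, .directed h w, ⟨c, hac, hct⟩, hw⟩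
  choose t p ht hp using hpath
  have htinj : Function.Injective t := by
    intro a b hab
    obtain ⟨c, hac, hc⟩ := ht a
    obtain ⟨d, hbd, hd⟩ := ht b
    obtain rfl : c = d := hf (by rw [hc, hd, hab])
    exact Subtype.ext (eq_of_reflTransGen_of_reflTransGen hf (hne a) (hne b) hac hbd)
  -- The image of `f` has as many elements as `U` and consists of a copy of `Sᶜ` and the `inr`
  -- values, which leaves `S.encard` for the latter.
  have hcard : S.encard = {t | ∃ c, f c = .inr t}.encard := by
    have h1 : (Set.univ : Set U).encard = Sᶜ.encard + {t | ∃ c, f c = .inr t}.encard := by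
      rw [← hf.encard_image, ← (Sum.inl_injective (β := U)).encard_image Sᶜ,
        ← (Sum.inr_injective (α := U)).encard_image {t | ∃ c, f c = .inr t},
        ← Set.encard_union_eq]
      · congr 1
        ext (x | x)
        · simpa using (hS x).symm
        · simp
      · rw [Set.disjoint_left]
        rintro _ ⟨x, -, rfl⟩ ⟨y, -, h⟩
        cases h
    have h2 := Set.encard_add_encard_compl S
    rw [h1, add_comm] at h2
    exact ENat.add_right_injective_of_ne_top (Set.toFinite Sᶜ).encard_lt_top.ne h2
  have hrange : Set.range t = {t | ∃ c, f c = .inr t} := by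
    refine (Set.toFinite _).eq_of_subset_of_encard_le ?_ ?_
    · rintro _ ⟨a, rfl⟩
      obtain ⟨c, -, hc⟩ := ht a
      exact ⟨c, hc⟩
    · rw [← hcard, ← Set.image_univ, htinj.encard_image, Set.encard_univ, ENat.card_coe_set_eq]
  have : Fintype S := Fintype.ofFinite S
  let e : Fin (Fintype.card S) ≃ S := (Fintype.equivFin S).symm
  have hSs : S.encard = (Fintype.card S : ℕ) := by
    rw [Set.encard_eq_coe_toFinset_card, Set.toFinset_card]
  refine ⟨Fintype.card S,
    { encard_source := hcard ▸ hSs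
      encard_target := hSs
      first := fun l => t (e l)
      last := fun l => e l
      path := fun l => p (e l)
      first_mem := fun l => hrange ▸ Set.mem_range_self _
      last_mem := fun l => (e l).2
      exists_first := fun v hv => by
        rw [← hrange] at hv
        obtain ⟨a, rfl⟩ := hv
        exact ⟨e.symm a, by simp⟩
      exists_last := fun v hv => ⟨e.symm ⟨v, hv⟩, by simp⟩ }, fun l m hlm => ?_⟩
  rw [Set.disjoint_left]
  intro v hl hm
  exact hlm (e.injective (Subtype.ext (eq_of_reflTransGen_of_reflTransGen hf (hne _) (hne _)
    (hp _ v hl) (hp _ v hm))))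

end MixedGraph

/-! ### From linear algebra to matchings. -/

lemma Matrix.exists_perm_forall_ne_zero_of_det_ne_zero {n : Type*} [Fintype n] [DecidableEq n]
    {R : Type*} [CommRing R] {M : Matrix n n R} (h : M.det ≠ 0) :
    ∃ σ : Equiv.Perm n, ∀ k, M (σ k) k ≠ 0 := by
  by_contra! hc
  refine h (M.det_apply.trans (Finset.sum_eq_zero fun σ _ => ?_))
  obtain ⟨k, hk⟩ := hc σ
  rw [show ∏ i, M (σ i) i = 0 from Finset.prod_eq_zero (Finset.mem_univ k) hk, smul_zero]

/-- Steinitz exchange together with the Leibniz formula: if the vectors `v j`, `j ∈ t`, span, any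
independent subfamily is contained in the range of an injection that picks nonzero entries. -/
lemma exists_injective_forall_ne_zero {n ι K : Type*} [Finite n] [Field K]
    (v : ι → n → K) {s t : Set ι} (hs : LinearIndepOn K v s) (hst : s ⊆ t)
    (ht : Submodule.span K (v '' t) = ⊤) :
    ∃ f : n → ι, Function.Injective f ∧ (∀ k, f k ∈ t) ∧ (∀ j ∈ s, ∃ k, f k = j) ∧
      ∀ k, v (f k) k ≠ 0 := by
  classical
  have := Fintype.ofFinite n
  obtain ⟨b, hbt, hsb, hspan, hb⟩ := exists_linearIndepOn_extension hs hst
  have htop : ⊤ ≤ Submodule.span K (Set.range fun j : b => v j) := by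
    rw [← ht, Submodule.span_le]
    simpa [Set.image_eq_range] using hspan
  let basis : Module.Basis b K (n → K) := .mk hb htop
  let e : n ≃ b := (Pi.basisFun K n).indexEquiv basis
  have hli : LinearIndependent K (Matrix.of fun k => v (e k)).row :=
    LinearIndependent.comp hb e e.injective
  have hdet : (Matrix.of fun k => v (e k)).det ≠ 0 :=
    ((Matrix.isUnit_iff_isUnit_det _).1 (Matrix.linearIndependent_rows_iff_isUnit.1 hli)).ne_zero
  obtain ⟨σ, hσ⟩ := Matrix.exists_perm_forall_ne_zero_of_det_ne_zero hdet
  refine ⟨fun k => e (σ k), Subtype.val_injective.comp (e.injective.comp σ.injective),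
    fun k => hbt (e (σ k)).2, fun j hj => ⟨σ.symm (e.symm ⟨j, hsb hj⟩), by simp⟩, hσ⟩

/-- The hypothesis `h` is the dual form of spanning: no nonzero functional kills the columns of `Ω`
outside `S` and those of `A` in `W`. The basis keeps every such column of `Ω`, so exactly the
elements of `S` have no predecessor in the matching. -/
lemma exists_halfColliderSystem_of_forall_eq_zero {U : Type*} [Fintype U] [DecidableEq U]
    (G : MixedGraph U) {Ω A : Matrix U U ℝ} (hΩ : IsUnit Ω)
    (hΩG : ∀ i j, i ≠ j → ¬ G.bidir.Adj j i → Ω i j = 0)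
    (hAG : ∀ i j, i ≠ j → ¬ G.dir j i → A i j = 0) (S W : Set U)
    (h : ∀ u : U → ℝ, (∀ j ∉ S, Matrix.vecMul u Ω j = 0) →
      (∀ j ∈ W, Matrix.vecMul u A j = 0) → u = 0) :
    ∃ Sb ⊆ W, ∃ (s : ℕ) (P : G.HalfColliderSystem Sb S s),
      ∀ l m, l ≠ m → Disjoint (P.path l).bidirectedPortion (P.path m).bidirectedPortion := by
  let v : U ⊕ U → U → ℝ := Sum.elim Ω.col A.col
  have hs : LinearIndepOn ℝ v (Sum.inl '' Sᶜ) := by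
    have h1 : LinearIndependent ℝ Ω.col := Matrix.linearIndependent_cols_iff_isUnit.2 hΩ
    exact LinearIndepOn.image_of_comp _ _ (h1.linearIndepOn Sᶜ)
  have ht : Submodule.span ℝ (v '' (Sum.inl '' Sᶜ ∪ Sum.inr '' W)) = ⊤ := by
    by_contra hne
    obtain ⟨φ, hφ, hle⟩ := Submodule.exists_le_ker_of_lt_top _ (lt_top_iff_ne_top.2 hne)
    let u : U → ℝ := fun k => φ (Pi.single k 1)
    have hu : ∀ x : U → ℝ, φ x = u ⬝ᵥ x := by
      intro x
      conv_lhs => rw [pi_eq_sum_univ' x]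
      simp [u, dotProduct, mul_comm]
    have hz : ∀ j ∈ Sum.inl '' Sᶜ ∪ Sum.inr '' W, u ⬝ᵥ v j = 0 := fun j hj => by
      rw [← hu]
      exact hle (Submodule.subset_span (Set.mem_image_of_mem v hj))
    have hu0 : u = 0 := h u (fun j hj => hz (.inl j) (.inl ⟨j, hj, rfl⟩))
      (fun j hj => hz (.inr j) (.inr ⟨j, hj, rfl⟩))
    exact hφ (LinearMap.ext fun x => by simp [hu, hu0])
  obtain ⟨f, hf, hft, hfs, hne⟩ := exists_injective_forall_ne_zero v hs Set.subset_union_left ht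
  refine ⟨{t | ∃ c, f c = .inr t}, ?_, G.exists_halfColliderSystem_of_injective S hf ?_ ?_ ?_⟩
  · rintro t ⟨c, hc⟩
    simpa [hc] using hft c
  · refine fun c => ⟨fun hc => hfs _ ⟨c, hc, rfl⟩, ?_⟩
    rintro ⟨d, hd⟩
    simpa [hd] using hft d
  · intro c d hcd
    by_contra! hc
    exact hne c (by simpa [hcd, v] using hΩG c d hc.1 fun h => hc.2 h.symm)
  · intro c d hcd
    by_contra! hc
    exact hne c (by simpa [hcd, v] using hAG c d hc.1 hc.2)

/-- If the graphical condition fails at `i`, some nonzero row vector can be added to the `i`-th row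
without leaving the model. -/
lemma MixedGraph.exists_ne_zero_of_not_halfColliderConditionAt {V : Type*} [Fintype V]
    [DecidableEq V] (G : MixedGraph V) {i : V} (hi : ¬ G.HalfColliderConditionAt i)
    {B Ω : Matrix V V ℝ} (hB : B ∈ G.coefficients) (hΩ : Ω ∈ G.errorCovariances) :
    ∃ u : V → ℝ, u ≠ 0 ∧ (∀ j, j ≠ i → j ∉ G.sib i → Matrix.vecMul u Ω j = 0) ∧
      ∀ j ∉ G.pa i, Matrix.vecMul u (1 - B) j = 0 := by
  contrapose! hi
  let ι : ({i}ᶜ : Set V) → V := Subtype.val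
  suffices h : ∀ u : ({i}ᶜ : Set V) → ℝ,
      (∀ j ∉ {v : ({i}ᶜ : Set V) | (v : V) ∈ G.sib i},
        Matrix.vecMul u (Ω.submatrix ι ι) j = 0) →
      (∀ j ∈ {v : ({i}ᶜ : Set V) | (v : V) ∉ G.pa i},
        Matrix.vecMul u ((1 - B).submatrix ι ι) j = 0) → u = 0 by
    refine exists_halfColliderSystem_of_forall_eq_zero (G.remove i)
      (hΩ.1.submatrix Subtype.val_injective).isUnit
      (fun a b hab h => hΩ.2 a b (Subtype.coe_ne_coe.2 hab) h)
      (fun a b hab h => ?_) _ _ h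
    rw [Matrix.submatrix_apply, Matrix.sub_apply, Matrix.one_apply_ne (Subtype.coe_ne_coe.2 hab),
      hB.2 a b h, sub_zero]
  intro u hu1 hu2
  have hsum : ∀ (x : ℝ) (g : V → ℝ),
      ∑ k, (if h : k = i then x else u ⟨k, h⟩) * g k = x * g i + ∑ k, u k * g (ι k) := by
    intro x g
    rw [Fintype.sum_eq_add_sum_subtype_ne _ i]
    congr 1
    · simp
    · refine Finset.sum_congr rfl fun k _ => ?_
      rw [dif_neg k.2]
      rfl
  have hBii : B i i = 0 := hB.2 i i (G.dir_irrefl i)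
  -- The value at `i` is forced by the vanishing of `w (1 - B)` at `i`. It does not affect the other
  -- required equations, since row `i` of `Ω` and of `1 - B` is zero in those columns.
  let w : V → ℝ := fun k => if h : k = i then ∑ k, u k * B (ι k) i else u ⟨k, h⟩
  have hw : w = 0 := by
    by_contra hw
    obtain ⟨j, hj, hne⟩ := hi w hw (fun j hji hj => by
      have h1 : Ω i j = 0 := hΩ.2 i j (Ne.symm hji) hj
      have h2 := hu1 ⟨j, hji⟩ hj
      rw [Matrix.vecMul, dotProduct, hsum, h1, mul_zero, zero_add]
      exact h2)
    refine hne ?_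
    rw [Matrix.vecMul, dotProduct, hsum]
    by_cases hji : j = i
    · subst hji
      simp only [Matrix.sub_apply, Matrix.one_apply_eq, hBii, sub_zero, mul_one]
      rw [← Finset.sum_add_distrib]
      refine Finset.sum_eq_zero fun k _ => ?_
      rw [Matrix.one_apply_ne k.2]
      ring
    · have h1 : (1 - B) i j = 0 := by
        rw [Matrix.sub_apply, Matrix.one_apply_ne (Ne.symm hji), hB.2 i j hj, sub_zero]
      rw [h1, mul_zero, zero_add]
      exact hu2 ⟨j, hji⟩ hj
  funext k
  have := congrFun hw k
  simpa [w, dif_neg (show (k : V) ≠ i from k.2)] using this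

/-! ### Row updates that preserve the covariance. -/

section RowUpdate

open Matrix

variable {V : Type*} [Fintype V] [DecidableEq V]

/-- The matrix that subtracts `t` times the combination `u` of all rows from the `i`-th row. -/
def rowUpdate (i : V) (u : V → ℝ) (t : ℝ) : Matrix V V ℝ :=
  1 - t • vecMulVec (Pi.single i 1) u

lemma det_rowUpdate (i : V) (u : V → ℝ) (t : ℝ) : (rowUpdate i u t).det = 1 - t * u i := by
  rw [rowUpdate, ← smul_vecMulVec, sub_eq_add_neg, ← neg_vecMulVec, vecMulVec_eq Unit,
    det_one_add_replicateCol_mul_replicateRow]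
  simp [sub_eq_add_neg]

lemma rowUpdate_mul_apply (i : V) (u : V → ℝ) (t : ℝ) (M : Matrix V V ℝ) (a b : V) :
    (rowUpdate i u t * M) a b = M a b - if a = i then t * vecMul u M b else 0 := by
  rw [rowUpdate, sub_mul, one_mul, smul_mul_assoc, vecMulVec_mul]
  by_cases h : a = i <;> simp [vecMulVec_apply, h]

lemma rowUpdate_mul_mul_transpose_apply (i : V) (u : V → ℝ) (t : ℝ) {M : Matrix V V ℝ}
    (hM : M.IsSymm) {a b : V} (hab : a ≠ b) :
    (rowUpdate i u t * M * (rowUpdate i u t)ᵀ) a b =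
      M a b - (if a = i then t * vecMul u M b else 0) -
        if b = i then t * vecMul u M a else 0 := by
  have h : rowUpdate i u t * M * (rowUpdate i u t)ᵀ =
      (rowUpdate i u t * (rowUpdate i u t * M)ᵀ)ᵀ := by
    simp [transpose_mul, Matrix.mul_assoc]
  rw [h, transpose_apply, rowUpdate_mul_apply, transpose_apply, rowUpdate_mul_apply]
  congr 1
  by_cases hb : b = i
  · have ha : a ≠ i := hb ▸ hab
    simp only [hb, if_true]
    congr 1
    have : (fun k => (rowUpdate i u t * M)ᵀ k a) = fun k => M k a := by
      funext k
      rw [transpose_apply, rowUpdate_mul_apply, if_neg ha, sub_zero, hM.apply]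
    exact congrArg (u ⬝ᵥ ·) this
  · simp [hb]

/-- A row update that respects the parents and siblings of `i` preserves the parameter space. -/
lemma MixedGraph.rowUpdate_mem_parameters (G : MixedGraph V) {i : V} {B Ω : Matrix V V ℝ}
    (hθ : (B, Ω) ∈ G.parameters) {u : V → ℝ}
    (hu : ∀ j, j ≠ i → j ∉ G.sib i → vecMul u Ω j = 0)
    (hu' : ∀ j ∉ G.pa i, vecMul u (1 - B) j = 0) {t : ℝ} (ht : 1 - t * u i ≠ 0) :
    (1 - rowUpdate i u t * (1 - B), rowUpdate i u t * Ω * (rowUpdate i u t)ᵀ) ∈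
      G.parameters := by
  obtain ⟨⟨hB, hBG⟩, hΩ, hΩG⟩ := hθ
  have hN : IsUnit (rowUpdate i u t) := by
    rw [isUnit_iff_isUnit_det, det_rowUpdate]
    exact ht.isUnit
  refine ⟨⟨?_, fun a b hab => ?_⟩, ?_, fun a b hab hadj => ?_⟩
  · simpa using hN.mul hB
  · have h0 : B a b = 0 := hBG a b hab
    change (1 - rowUpdate i u t * (1 - B)) a b = 0
    rw [Matrix.sub_apply, rowUpdate_mul_apply, Matrix.sub_apply, h0]
    by_cases ha : a = i
    · subst ha
      simp [hu' b hab]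
    · simp [ha]
  · simpa using hΩ.mul_mul_conjTranspose_same (vecMul_injective_of_isUnit hN)
  · have h0 : Ω a b = 0 := hΩG a b hab hadj
    have hsymm : Ω.IsSymm := by simpa [IsHermitian, IsSymm] using hΩ.1
    change (rowUpdate i u t * Ω * (rowUpdate i u t)ᵀ) a b = 0
    rw [rowUpdate_mul_mul_transpose_apply i u t hsymm hab, h0]
    have h1 : a = i → vecMul u Ω b = 0 := fun h => hu b (h ▸ hab.symm) (h ▸ hadj)
    have h2 : b = i → vecMul u Ω a = 0 := fun h =>
      hu a (h ▸ hab) (h ▸ fun h' => hadj h'.symm)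
    split_ifs with ha hb hb <;> simp_all

lemma semCovariance_rowUpdate {i : V} {B Ω : Matrix V V ℝ} {u : V → ℝ} {t : ℝ}
    (ht : 1 - t * u i ≠ 0) :
    semCovariance (1 - rowUpdate i u t * (1 - B), rowUpdate i u t * Ω * (rowUpdate i u t)ᵀ) =
      semCovariance (B, Ω) := by
  have hN : IsUnit (rowUpdate i u t).det := by
    rw [det_rowUpdate]
    exact ht.isUnit
  simp only [semCovariance, sub_sub_cancel, transpose_mul, transpose_nonsing_inv, Matrix.mul_inv_rev]
  have hN' : IsUnit (rowUpdate i u t)ᵀ.det := by rwa [det_transpose]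
  simp only [Matrix.mul_assoc]
  rw [mul_nonsing_inv_cancel_left _ _ hN', nonsing_inv_mul_cancel_left _ _ hN]

end RowUpdate

lemma MixedGraph.infinite_setOf_semCovariance_eq {V : Type*} [Fintype V] [DecidableEq V]
    (G : MixedGraph V) {i : V} (hi : ¬ G.HalfColliderConditionAt i)
    {θ : Matrix V V ℝ × Matrix V V ℝ} (hθ : θ ∈ G.parameters) :
    {θ' ∈ G.parameters | semCovariance θ' = semCovariance θ}.Infinite := by
  obtain ⟨B, Ω⟩ := θ
  obtain ⟨u, hu0, hu, hu'⟩ := G.exists_ne_zero_of_not_halfColliderConditionAt hi hθ.1 hθ.2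
  have hinf : {t : ℝ | 1 - t * u i ≠ 0}.Infinite := by
    refine ((Set.finite_singleton (u i)⁻¹).subset fun t ht => ?_).infinite_compl.mono
      (s := {t : ℝ | 1 - t * u i = 0}ᶜ) fun t ht => ht
    exact eq_inv_of_mul_eq_one_left (sub_eq_zero.1 ht).symm
  refine Set.infinite_of_injOn_mapsTo (f := fun t => (1 - rowUpdate i u t * (1 - B),
    rowUpdate i u t * Ω * (rowUpdate i u t).transpose)) ?_ (fun t ht =>
      ⟨G.rowUpdate_mem_parameters hθ hu hu' ht, semCovariance_rowUpdate ht⟩) hinf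
  -- Row `i` of the new `B` is affine in `t` with slope `u (1 - B)`, which is nonzero since `1 - B`
  -- is invertible.
  obtain ⟨b, hb⟩ : ∃ b, Matrix.vecMul u (1 - B) b ≠ 0 := by
    by_contra! h
    exact hu0 (Matrix.vecMul_injective_of_isUnit hθ.1.1 ((funext h).trans (Matrix.zero_vecMul (1 - B)).symm))
  intro t _ t' _ htt'
  have h := congrFun (congrFun (sub_right_injective (Prod.ext_iff.1 htt').1) i) b
  simpa [rowUpdate_mul_apply, hb] using h

lemma MixedGraph.zero_one_mem_parameters {V : Type*} [Fintype V] [DecidableEq V]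
    (G : MixedGraph V) : ((0, 1) : Matrix V V ℝ × Matrix V V ℝ) ∈ G.parameters :=
  ⟨⟨by simp, fun _ _ _ => rfl⟩, Matrix.PosDef.one, fun _ _ h _ => Matrix.one_apply_ne h⟩

theorem mainTheorem7 {V : Type*} [Fintype V] [DecidableEq V] (G : MixedGraph V)
    (hG : ¬ G.HalfColliderCondition) :
    ¬ G.ParametersIdentifiable ∧
      ∀ θ ∈ G.parameters,
        {θ' ∈ G.parameters | semCovariance θ' = semCovariance θ}.Infinite := by
  obtain ⟨i, hi⟩ := not_forall.1 hG
  refine ⟨fun hinj => ?_, fun θ hθ => G.infinite_setOf_semCovariance_eq hi hθ⟩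
  -- Injectivity fails only if some parameter exists; `(0, 1)` always does.
  refine G.infinite_setOf_semCovariance_eq hi G.zero_one_mem_parameters
    (Set.Subsingleton.finite fun θ hθ θ' hθ' => hinj hθ.1 hθ'.1 ?_)
  rw [semDistribution, semDistribution, hθ.2, hθ'.2]
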